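/- Let $n\ge 1$, $\Omega=B(0,1)\subset\mathbb R^n$ and $\Omega_k=B(0,1-\tfrac1k)$ for integers $k\ge 2$. Call a continuous function $H:\overline\Omega\times\mathbb R^n\to\mathbb R$ admissible if * (H1) there is $C_1>0$ with $-H(x,p)\le C_1$ for all $(x,p)\in\overline\Omega\times\mathbb R^n$; * (H2) there is $C_2>0$ with $|H(x,0)|\le C_2$ for all $x\in\overline\Omega$; * (H3c) for each $R>0$ there is a constant $C_R$ with $|H(x,p)-H(y,p)|\le C_R|x-y|$ and $|H(x,p)-H(x,q)|\le C_R|p-q|$ for all $x,y\in\overline\Omega$ and all $p,q\in\mathbb R^n$ with $|p|,|q|\le R$; * (H4) $\inf_{x\in\overline\Omega}H(x,p)\to+\infty$ as $|p|\to\infty$. For an open ball $U\subseteq\Omega$ centred at $0$, a state-constraint viscosity solution of $v+H(x,Dv)=0$ in $U$ is a function $v\in\mathrm{BUC}(\overline U)$ (bounded and uniformly continuous on $\overline U$) such that * $v(x)+H(x,D\varphi(x))\le 0$ whenever $x\in U$, $\varphi\in C^1(U)$ and $v-\varphi$ has a local maximum over $U$ at $x$; * $v(x)+H(x,D\varphi(x))\ge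 0$ whenever $x\in\overline U$, $\varphi\in C^1(\overline U)$ and $v-\varphi$ has a local minimum over $\overline U$ at $x$. Then the following hold. 1. For every admissible $H$ there is a constant $C>0$, depending only on $H$ (and $n$), such that for every $k\ge2$, if $u$ and $u_k$ are state-constraint viscosity solutions of $v+H(x,Dv)=0$ in $\Omega$ and in $\Omega_k$ respectively, then $$0\le u_k(x)-u(x)\le \frac Ck\qquad\text{for all }x\in\overline{B\left(0,1-\tfrac1k\right)}.$$ 2. The rate $O(1/k)$ is optimal: there are an admissible $H$, state-constraint viscosity solutions $u$ in $\Omega$ and $u_k$ in $\Omega_k$ ($k\ge2$), and a constant $c>0$ such that $$u_k(x)-u(x)\ge\frac ck\qquad\text{for all }k\ge2\text{ and all }x\in\overline{B\left(0,1-\tfrac1k\right)}.$$ -/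

import Mathlib

open Set Filter Topology

namespace StateConstraint

/-- `v` is bounded and uniformly continuous on `s`. -/
def IsBUCOn {n : ℕ} (v : EuclideanSpace ℝ (Fin n) → ℝ) (s : Set (EuclideanSpace ℝ (Fin n))) :
    Prop :=
  (∃ M : ℝ, ∀ x ∈ s, |v x| ≤ M) ∧ UniformContinuousOn v s

/-- `v ∈ BUC(Ω)` is a viscosity subsolution of `v + H(x, Dv) = 0` in the open set `Ω`. -/
def IsViscositySubsolution {n : ℕ}
    (H : EuclideanSpace ℝ (Fin n) → EuclideanSpace ℝ (Fin n) → ℝ)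
    (Ω : Set (EuclideanSpace ℝ (Fin n))) (v : EuclideanSpace ℝ (Fin n) → ℝ) : Prop :=
  IsBUCOn v Ω ∧
    ∀ x ∈ Ω, ∀ φ : EuclideanSpace ℝ (Fin n) → ℝ, ContDiffOn ℝ 1 φ Ω →
      IsLocalMaxOn (fun y => v y - φ y) Ω x → v x + H x (gradient φ x) ≤ 0

/-- `v ∈ BUC(closure Ω)` is a viscosity supersolution of `v + H(x, Dv) = 0` on `closure Ω`.
Boundary points are included, and minima are taken relative to `closure Ω`.  The test functions
are `C¹` on `closure Ω`, and their gradient is the one within `closure Ω` (it is uniquely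
determined when `Ω` is a nonempty open ball). -/
def IsViscositySupersolution {n : ℕ}
    (H : EuclideanSpace ℝ (Fin n) → EuclideanSpace ℝ (Fin n) → ℝ)
    (Ω : Set (EuclideanSpace ℝ (Fin n))) (v : EuclideanSpace ℝ (Fin n) → ℝ) : Prop :=
  IsBUCOn v (closure Ω) ∧
    ∀ x ∈ closure Ω, ∀ φ : EuclideanSpace ℝ (Fin n) → ℝ, ContDiffOn ℝ 1 φ (closure Ω) →
      IsLocalMinOn (fun y => v y - φ y) (closure Ω) x →
        0 ≤ v x + H x (gradientWithin φ (closure Ω) x)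

/-- State-constraint viscosity solution: a subsolution in `Ω` and a supersolution on
`closure Ω`. -/
def IsStateConstraintSolution {n : ℕ}
    (H : EuclideanSpace ℝ (Fin n) → EuclideanSpace ℝ (Fin n) → ℝ)
    (Ω : Set (EuclideanSpace ℝ (Fin n))) (v : EuclideanSpace ℝ (Fin n) → ℝ) : Prop :=
  IsViscositySubsolution H Ω v ∧ IsViscositySupersolution H Ω v

/-- The assumptions on a Hamiltonian `H : closure Ω × ℝⁿ → ℝ`; the values of `H` at points
outside `closure Ω` play no role. -/
structure IsAdmissibleHamiltonian {n : ℕ} (Ω : Set (EuclideanSpace ℝ (Fin n)))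
    (H : EuclideanSpace ℝ (Fin n) → EuclideanSpace ℝ (Fin n) → ℝ) : Prop where
  continuousOn : ContinuousOn
    (fun z : EuclideanSpace ℝ (Fin n) × EuclideanSpace ℝ (Fin n) => H z.1 z.2)
    (closure Ω ×ˢ (univ : Set (EuclideanSpace ℝ (Fin n))))
  /-- `H` is bounded from below. -/
  bddBelow : ∃ C₁ : ℝ, 0 < C₁ ∧ ∀ x ∈ closure Ω, ∀ p, -H x p ≤ C₁
  /-- `H(·, 0)` is bounded. -/
  bdd_zero : ∃ C₂ : ℝ, 0 < C₂ ∧ ∀ x ∈ closure Ω, |H x 0| ≤ C₂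
  /-- `H` is Lipschitz in each variable, for momenta in a fixed ball. -/
  lipschitz : ∀ R : ℝ, 0 < R → ∃ C : ℝ, ∀ x ∈ closure Ω, ∀ y ∈ closure Ω,
    ∀ p q : EuclideanSpace ℝ (Fin n), ‖p‖ ≤ R → ‖q‖ ≤ R →
      |H x p - H y p| ≤ C * ‖x - y‖ ∧ |H x p - H x q| ≤ C * ‖p - q‖
  /-- `H` is coercive in `p`, uniformly in `x`. -/
  coercive : Tendsto (fun p => ⨅ x : closure Ω, H x p)
    (Bornology.cobounded (EuclideanSpace ℝ (Fin n))) atTop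

/-- The limit domain `B(0, 1)`. -/
def unitBall (n : ℕ) : Set (EuclideanSpace ℝ (Fin n)) := Metric.ball 0 1

/-- The nested domains `B(0, 1 - 1/k)`. -/
def nestedBall (n k : ℕ) : Set (EuclideanSpace ℝ (Fin n)) := Metric.ball 0 (1 - 1 / (k : ℝ))

end StateConstraint

/-! Everything rests on comparison. A state-constraint supersolution keeps its inequality at
boundary points, so doubling variables only requires the subsolution's maximum point to stay inside
its own open ball. With `θ = 1` this holds for `u` against `u_k`, because the closed small ball lies
inside the unit ball, and it gives `u ≤ u_k`. In the other direction `u_k` is evaluated at `θ x`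
with `θ = 1 - 2/k`, and the contraction costs `O(1 - θ)` (`comparison_of_contraction`). Replacing
`u_k (θ x)` by `u_k x` costs another `O(1 - θ)` by the Lipschitz estimate
`sub_le_of_norm_gradient_le`. The constants do not depend on `k`: supersolutions are at least `-C₂`,
so `H ≤ C₂` at every subsolution test, and coercivity bounds the momentum by a single `L`.
Optimality comes from explicit radial solutions for `H x p = ‖p‖ + ‖x‖`. -/

namespace StateConstraint

/-! ### Lipschitz estimate from gradient bounds on test functions. -/

section Gradients

variable {E : Type*} [NormedAddCommGroup E] [InnerProductSpace ℝ E]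

lemma gradientWithin_eq_gradient [CompleteSpace E] {φ : E → ℝ} {s : Set E} {x : E}
    (hφ : DifferentiableAt ℝ φ x) (hs : UniqueDiffWithinAt ℝ s x) :
    gradientWithin φ s x = gradient φ x := by
  simp only [gradientWithin, gradient, hφ.fderivWithin hs]

/-- The radial penalty `expNegInvGlue (‖z‖² - r²)` does not decrease in the direction `z - y`
when `‖y‖ ≤ r`. -/
lemma deriv_expNegInvGlue_mul_inner_nonneg {y z : E} {r : ℝ} (hy : ‖y‖ ≤ r) :
    0 ≤ deriv expNegInvGlue (‖z‖ ^ 2 - r ^ 2) * inner ℝ z (z - y) := by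
  have hd : 0 ≤ deriv expNegInvGlue (‖z‖ ^ 2 - r ^ 2) := expNegInvGlue.monotone.deriv_nonneg
  rcases le_or_gt r ‖z‖ with h | h
  · refine mul_nonneg hd ?_
    rw [inner_sub_right, real_inner_self_eq_norm_sq]
    nlinarith [real_inner_le_norm z y, norm_nonneg z, norm_nonneg y]
  · have hneg : ‖z‖ ^ 2 - r ^ 2 < 0 := by nlinarith [norm_nonneg z]
    have : deriv expNegInvGlue (‖z‖ ^ 2 - r ^ 2) = 0 := by
      have h0 : expNegInvGlue =ᶠ[𝓝 (‖z‖ ^ 2 - r ^ 2)] fun _ => 0 := by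
        filter_upwards [Iio_mem_nhds hneg] with t ht
        exact expNegInvGlue.zero_of_nonpos (le_of_lt ht)
      rw [h0.deriv_eq, deriv_const]
    rw [this, zero_mul]

/-- A smoothed cone with a radial penalty, the test function for the Lipschitz estimate. -/
noncomputable def penalizedCone (α δ K r : ℝ) (y z : E) : ℝ :=
  α * √(δ ^ 2 + ‖z - y‖ ^ 2) + K * expNegInvGlue (‖z‖ ^ 2 - r ^ 2)

lemma contDiff_penalizedCone (α K r : ℝ) {δ : ℝ} (hδ : 0 < δ) (y : E) :
    ContDiff ℝ 1 (penalizedCone α δ K r y) := by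
  unfold penalizedCone
  refine (contDiff_const.mul (ContDiff.sqrt ?_ fun z => by positivity)).add
    (contDiff_const.mul ((expNegInvGlue.contDiff (n := 1)).comp ?_))
  · exact contDiff_const.add ((contDiff_id.sub contDiff_const).norm_sq ℝ)
  · exact (contDiff_id.norm_sq ℝ).sub contDiff_const

/-- The gradient of the penalty may be huge, but it pairs nonnegatively with `z - y`; dropping it
leaves the slope of the cone alone, whatever `K` is. -/
lemma le_inner_gradient_penalizedCone [CompleteSpace E] {α δ K r : ℝ} (hδ : 0 < δ) (hK : 0 ≤ K) {y : E}
    (hy : ‖y‖ ≤ r) (z : E) :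
    α * (‖z - y‖ ^ 2 / √(δ ^ 2 + ‖z - y‖ ^ 2)) ≤
      inner ℝ (gradient (penalizedCone α δ K r y) z) (z - y) := by
  have h1 : HasFDerivAt (fun z : E => ‖z - y‖ ^ 2) _ z :=
    ((hasFDerivAt_id z).sub_const y).norm_sq
  have h2 : HasFDerivAt (fun z : E => ‖z‖ ^ 2) _ z := (hasFDerivAt_id z).norm_sq
  have h3 := ((h1.const_add (δ ^ 2)).sqrt (by positivity)).const_mul α
  have he : HasDerivAt expNegInvGlue (deriv expNegInvGlue (‖z‖ ^ 2 - r ^ 2)) (‖z‖ ^ 2 - r ^ 2) :=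
    ((expNegInvGlue.contDiff (n := 1)).differentiable one_ne_zero _).hasDerivAt
  have h4 := (he.comp_hasFDerivAt z (h2.sub_const (r ^ 2))).const_mul K
  have h5 : HasFDerivAt (penalizedCone α δ K r y) _ z := h3.add h4
  have hp := mul_nonneg hK (deriv_expNegInvGlue_mul_inner_nonneg (z := z) hy)
  rw [inner_gradient_left, h5.fderiv]
  simp only [id_eq, add_apply, smul_apply,
    ContinuousLinearMap.comp_apply, ContinuousLinearMap.id_apply, innerSL_apply_apply,
    real_inner_self_eq_norm_sq, smul_eq_mul, nsmul_eq_mul]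
  have : α * (‖z - y‖ ^ 2 / √(δ ^ 2 + ‖z - y‖ ^ 2)) =
      α * (1 / (2 * √(δ ^ 2 + ‖z - y‖ ^ 2)) * (((2 : ℕ) : ℝ) * ‖z - y‖ ^ 2)) := by
    have : √(δ ^ 2 + ‖z - y‖ ^ 2) ≠ 0 := by positivity
    push_cast; field_simp
  rw [this]
  push_cast
  nlinarith

/-- A bounded continuous function on a ball whose test functions from above have gradients of norm
at most `L` is Lipschitz. -/
theorem sub_le_of_norm_gradient_le [ProperSpace E] {v : E → ℝ} {ρ M L : ℝ} (hL : 0 < L)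
    (hv : ContinuousOn v (Metric.ball 0 ρ)) (hM : ∀ x ∈ Metric.ball (0 : E) ρ, |v x| ≤ M)
    (hg : ∀ x ∈ Metric.ball (0 : E) ρ, ∀ φ : E → ℝ, ContDiff ℝ 1 φ →
      IsLocalMaxOn (fun y => v y - φ y) (Metric.ball 0 ρ) x → ‖gradient φ x‖ ≤ L)
    {x y : E} (hx : x ∈ Metric.ball (0 : E) ρ) (hy : y ∈ Metric.ball (0 : E) ρ) :
    v x - v y ≤ 2 * L * ‖x - y‖ := by
  have key : ∀ δ : ℝ, 0 < δ → ∃ z ∈ Metric.ball (0 : E) ρ, ‖z - y‖ ≤ δ ∧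
      v x ≤ v z + 2 * L * (δ + ‖x - y‖) := by
    intro δ hδ
    rw [mem_ball_zero_iff] at hx hy
    obtain ⟨r, hr⟩ : ∃ r, r = max ‖x‖ ‖y‖ := ⟨_, rfl⟩
    have hxr : ‖x‖ ≤ r := hr ▸ le_max_left _ _
    have hyr : ‖y‖ ≤ r := hr ▸ le_max_right _ _
    have hrρ : r < ρ := hr ▸ max_lt hx hy
    obtain ⟨ρ', h1, h2⟩ := exists_between hrρ
    have hr0 : 0 ≤ r := (norm_nonneg x).trans hxr
    have he : 0 < expNegInvGlue (ρ' ^ 2 - r ^ 2) := expNegInvGlue.pos_of_pos (by nlinarith)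
    have hM0 : 0 ≤ M := (abs_nonneg _).trans (hM x (by simpa using hx))
    -- With this `A`, the penalty on the sphere `‖z‖ = ρ'` exceeds the oscillation of `v` plus the
    -- value of the cone at `x`, so the maximum is not attained there.
    set A := 2 * M + 2 * L * √(δ ^ 2 + ‖x - y‖ ^ 2) + 1 with hA
    have hA0 : 0 < A := by positivity
    set K := A / expNegInvGlue (ρ' ^ 2 - r ^ 2) with hK
    have hKe : K * expNegInvGlue (ρ' ^ 2 - r ^ 2) = A := by rw [hK]; field_simp
    have hK0 : 0 ≤ K := by positivity
    have hsub : Metric.closedBall (0 : E) ρ' ⊆ Metric.ball 0 ρ :=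
      Metric.closedBall_subset_ball h2
    have hC := contDiff_penalizedCone (2 * L) K r hδ y
    obtain ⟨z, hz, hmax⟩ := (isCompact_closedBall (0 : E) ρ').exists_isMaxOn
      ⟨x, by simpa using hxr.trans h1.le⟩
      ((hv.mono hsub).sub hC.continuous.continuousOn)
    have hxz : v x - penalizedCone (2 * L) δ K r y x ≤ v z - penalizedCone (2 * L) δ K r y z :=
      hmax (by simpa using hxr.trans h1.le)
    have hxp : penalizedCone (2 * L) δ K r y x = 2 * L * √(δ ^ 2 + ‖x - y‖ ^ 2) := by
      rw [penalizedCone, expNegInvGlue.zero_of_nonpos (by nlinarith [norm_nonneg x]), mul_zero,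
        add_zero]
    have hcone : 0 ≤ 2 * L * √(δ ^ 2 + ‖z - y‖ ^ 2) := by positivity
    have hzlt : ‖z‖ < ρ' := by
      refine lt_of_le_of_ne (by simpa using hz) fun hzρ => ?_
      have : penalizedCone (2 * L) δ K r y z = 2 * L * √(δ ^ 2 + ‖z - y‖ ^ 2) + A := by
        rw [penalizedCone, hzρ, hKe]
      have b1 := (abs_le.1 (hM x (by simpa using hx))).1
      have b2 := (abs_le.1 (hM z (hsub hz))).2
      linarith
    have hloc : IsLocalMaxOn (fun w => v w - penalizedCone (2 * L) δ K r y w)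
        (Metric.ball 0 ρ) z := by
      refine IsLocalMax.on ?_ _
      exact hmax.isLocalMax (Filter.mem_of_superset
        (Metric.isOpen_ball.mem_nhds (by simpa using hzlt)) Metric.ball_subset_closedBall)
    have hgz := hg z (hsub hz) _ hC hloc
    have hin := le_inner_gradient_penalizedCone (α := 2 * L) hδ hK0 hyr z
    -- The cone has asymptotic slope `2L`; beyond distance `δ` its radial slope is still above `L`,
    -- against the gradient bound.
    have hzy : ‖z - y‖ ≤ δ := by
      by_contra! hlt
      have hup : inner ℝ (gradient (penalizedCone (2 * L) δ K r y) z) (z - y) ≤ L * ‖z - y‖ :=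
        (real_inner_le_norm _ _).trans (mul_le_mul_of_nonneg_right hgz (norm_nonneg _))
      have hd : 0 < ‖z - y‖ := hδ.trans hlt
      have hs : √(δ ^ 2 + ‖z - y‖ ^ 2) < 2 * ‖z - y‖ := by
        rw [Real.sqrt_lt' (by positivity)]
        nlinarith
      have hs0 : 0 < √(δ ^ 2 + ‖z - y‖ ^ 2) := by positivity
      have : ‖z - y‖ / 2 < ‖z - y‖ ^ 2 / √(δ ^ 2 + ‖z - y‖ ^ 2) := by
        rw [lt_div_iff₀ hs0]
        nlinarith
      nlinarith
    refine ⟨z, hsub hz, hzy, ?_⟩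
    have hpz : 0 ≤ penalizedCone (2 * L) δ K r y z :=
      add_nonneg hcone (mul_nonneg hK0 (expNegInvGlue.nonneg _))
    have hsq : √(δ ^ 2 + ‖x - y‖ ^ 2) ≤ δ + ‖x - y‖ := by
      rw [Real.sqrt_le_left (by positivity)]
      nlinarith [norm_nonneg (x - y)]
    nlinarith
  refine le_of_forall_pos_le_add fun η hη => ?_
  have hcy := Metric.continuousAt_iff.1 (hv.continuousAt (Metric.isOpen_ball.mem_nhds hy))
    (η / 2) (by positivity)
  obtain ⟨d, hd, hcd⟩ := hcy
  obtain ⟨z, hz, hzy, hle⟩ := key (min (d / 2) (η / (4 * L))) (by positivity)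
  have hvz := hcd (x := z) (by
    rw [dist_eq_norm]
    exact (hzy.trans (min_le_left _ _)).trans_lt (by linarith))
  rw [Real.dist_eq] at hvz
  have h3 := (abs_lt.1 hvz).2
  have h4 : 2 * L * min (d / 2) (η / (4 * L)) ≤ η / 2 := by
    calc 2 * L * min (d / 2) (η / (4 * L)) ≤ 2 * L * (η / (4 * L)) := by
          gcongr; exact min_le_right _ _
      _ = η / 2 := by field_simp; norm_num
  linarith

end Gradients

/-! ### Gradient bounds from one-sided increments. -/

section Gradients

variable {E : Type*} [NormedAddCommGroup E] [InnerProductSpace ℝ E] [CompleteSpace E]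

/-- Differentiate along the steepest descent direction `-∇φ`. -/
lemma norm_gradient_le_of_sub_le {φ : E → ℝ} {x : E} {s : ℝ} (hφ : DifferentiableAt ℝ φ x)
    (hs : 0 ≤ s) (h : ∀ᶠ y in 𝓝 x, φ x - φ y ≤ s * ‖y - x‖) : ‖gradient φ x‖ ≤ s := by
  by_contra! hlt
  set p := gradient φ x with hp
  have hline : Tendsto (fun t : ℝ => x - t • p) (𝓝 0) (𝓝 x) := by
    have : Continuous fun t : ℝ => x - t • p := by fun_prop
    simpa using this.tendsto 0
  have hd : HasDerivAt (fun t : ℝ => φ (x - t • p)) (-‖p‖ ^ 2) 0 := by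
    have h1 : HasDerivAt (fun t : ℝ => x - t • p) (-p) 0 := by
      simpa using ((hasDerivAt_id (0 : ℝ)).smul_const p).const_sub x
    have h2 : HasFDerivAt φ (fderiv ℝ φ x) (x - (0 : ℝ) • p) := by
      simpa using hφ.hasFDerivAt
    have h3 := h2.comp_hasDerivAt (0 : ℝ) h1
    have h4 : fderiv ℝ φ x (-p) = -‖p‖ ^ 2 := by
      rw [← inner_gradient_left, ← hp, inner_neg_right, real_inner_self_eq_norm_sq]
    rwa [h4] at h3
  have hp0 : 0 < ‖p‖ := hs.trans_lt hlt
  have htend := (hasDerivWithinAt_iff_tendsto_slope' (s := Ioi (0 : ℝ)) (by simp)).1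
    hd.hasDerivWithinAt
  have hle : -(s * ‖p‖) ≤ -‖p‖ ^ 2 := by
    refine ge_of_tendsto htend ?_
    filter_upwards [(hline.mono_left nhdsWithin_le_nhds).eventually h, self_mem_nhdsWithin]
      with t ht ht0
    rw [mem_Ioi] at ht0
    rw [slope_def_field, sub_zero, le_div_iff₀ ht0]
    rw [sub_sub_cancel_left, norm_neg, norm_smul, Real.norm_of_nonneg ht0.le] at ht
    simp only [zero_smul, sub_zero]
    linarith
  nlinarith

lemma le_norm_gradient_of_sub_le {φ : E → ℝ} {x e : E} {s : ℝ} {g : ℝ → ℝ}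
    (hφ : DifferentiableAt ℝ φ x) (he : ‖e‖ = 1) (hg : HasDerivAt g (-s) 0)
    (h : ∀ᶠ t in 𝓝[>] (0 : ℝ), φ (x + t • e) - φ x ≤ g t - g 0) : s ≤ ‖gradient φ x‖ := by
  have hd : HasDerivAt (fun t : ℝ => φ (x + t • e)) (inner ℝ (gradient φ x) e) 0 := by
    have h1 : HasDerivAt (fun t : ℝ => x + t • e) e 0 := by
      simpa using ((hasDerivAt_id (0 : ℝ)).smul_const e).const_add x
    have h2 : HasFDerivAt φ (fderiv ℝ φ x) (x + (0 : ℝ) • e) := by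
      simpa using hφ.hasFDerivAt
    rw [inner_gradient_left]
    exact h2.comp_hasDerivAt (0 : ℝ) h1
  have ht1 := (hasDerivWithinAt_iff_tendsto_slope' (s := Ioi (0 : ℝ)) (by simp)).1
    hd.hasDerivWithinAt
  have ht2 := (hasDerivWithinAt_iff_tendsto_slope' (s := Ioi (0 : ℝ)) (by simp)).1
    hg.hasDerivWithinAt
  have hle : inner ℝ (gradient φ x) e ≤ -s := by
    refine le_of_tendsto_of_tendsto ht1 ht2 ?_
    filter_upwards [h, self_mem_nhdsWithin] with t ht ht0
    rw [mem_Ioi] at ht0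
    rw [slope_def_field, slope_def_field, sub_zero]
    refine div_le_div_of_nonneg_right ?_ ht0.le
    simpa using ht
  have := (abs_le.1 (abs_real_inner_le_norm (gradient φ x) e)).1
  rw [he, mul_one] at this
  linarith

end Gradients

/-! ### Explicit radial solutions. -/

section Example

/-- The value function of `v + ‖Dv‖ + ‖x‖ = 0` with state constraint in `B(0, R)`. -/
noncomputable def radialValue (n : ℕ) (R : ℝ) (x : EuclideanSpace ℝ (Fin n)) : ℝ :=
  Real.exp (‖x‖ - R) - ‖x‖ - 1

variable {n : ℕ}

lemma isAdmissibleHamiltonian_norm_add_norm (n : ℕ) :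
    IsAdmissibleHamiltonian (unitBall n) fun x p => ‖p‖ + ‖x‖ where
  continuousOn := by fun_prop
  bddBelow := ⟨1, one_pos, fun x _ p => by linarith [norm_nonneg x, norm_nonneg p]⟩
  bdd_zero := by
    refine ⟨1, one_pos, fun x hx => ?_⟩
    have := Metric.closure_ball_subset_closedBall hx
    simpa using this
  lipschitz R _ := by
    refine ⟨1, fun x _ y _ p q _ _ => ⟨?_, ?_⟩⟩
    · simpa using abs_norm_sub_norm_le x y
    · simpa using abs_norm_sub_norm_le p q
  coercive := by
    have : Nonempty (closure (unitBall n)) :=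
      ⟨⟨0, subset_closure (by simp [unitBall])⟩⟩
    refine tendsto_atTop_mono (fun p => ?_) tendsto_norm_cobounded_atTop
    exact le_ciInf fun x => by linarith [norm_nonneg (x : EuclideanSpace ℝ (Fin n))]

lemma continuous_radialValue (R : ℝ) : Continuous (radialValue n R) := by
  unfold radialValue; fun_prop

lemma isBUCOn_closedBall {v : EuclideanSpace ℝ (Fin n) → ℝ} (hv : Continuous v) (R : ℝ) :
    IsBUCOn v (Metric.closedBall 0 R) := by
  refine ⟨?_, (isCompact_closedBall 0 R).uniformContinuousOn_of_continuous hv.continuousOn⟩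
  simpa using (isCompact_closedBall 0 R).exists_bound_of_continuousOn hv.continuousOn

/-- The profile `t ↦ exp (t - R) - t - 1` is convex with slope `-(1 - exp (t - R))`, so it lies
above its tangent at `‖x‖`; then `‖y‖ - ‖x‖ ≤ ‖y - x‖`. -/
lemma radialValue_sub_le {R : ℝ} {x y : EuclideanSpace ℝ (Fin n)} (hx : ‖x‖ ≤ R) :
    radialValue n R x - radialValue n R y ≤ (1 - Real.exp (‖x‖ - R)) * ‖y - x‖ := by
  have h1 : Real.exp (‖y‖ - R) = Real.exp (‖x‖ - R) * Real.exp (‖y‖ - ‖x‖) := by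
    rw [← Real.exp_add]; congr 1; ring
  have h2 := Real.add_one_le_exp (‖y‖ - ‖x‖)
  have h3 : Real.exp (‖x‖ - R) ≤ 1 := Real.exp_le_one_iff.2 (by linarith)
  have h4 := norm_sub_norm_le y x
  have h5 := mul_le_mul_of_nonneg_left h2 (Real.exp_pos (‖x‖ - R)).le
  have h6 := mul_le_mul_of_nonneg_left h4 (sub_nonneg.2 h3)
  simp only [radialValue]
  rw [h1]
  nlinarith

lemma isStateConstraintSolution_radialValue (hn : 1 ≤ n) {R : ℝ} (hR : 0 < R) :
    IsStateConstraintSolution (fun x p => ‖p‖ + ‖x‖)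
      (Metric.ball (0 : EuclideanSpace ℝ (Fin n)) R) (radialValue n R) := by
  have hbuc := isBUCOn_closedBall (continuous_radialValue (n := n) R) R
  refine ⟨⟨⟨?_, hbuc.2.mono Metric.ball_subset_closedBall⟩, ?_⟩, ?_, ?_⟩
  · obtain ⟨M, hM⟩ := hbuc.1
    exact ⟨M, fun x hx => hM x (Metric.ball_subset_closedBall hx)⟩
  · intro x hx φ hφ hmax
    have hnhds := Metric.isOpen_ball.mem_nhds hx
    rw [mem_ball_zero_iff] at hx
    have hs : 0 ≤ 1 - Real.exp (‖x‖ - R) :=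
      sub_nonneg.2 (Real.exp_le_one_iff.2 (by linarith))
    have := norm_gradient_le_of_sub_le
      ((hφ.contDiffAt hnhds).differentiableAt one_ne_zero) hs (by
        filter_upwards [hmax.isLocalMax hnhds] with y hy
        have := radialValue_sub_le (y := y) hx.le
        linarith)
    simp only [radialValue]
    linarith
  · rwa [closure_ball _ hR.ne']
  · rw [closure_ball _ hR.ne']
    intro x hx φ hφ hmin
    rw [mem_closedBall_zero_iff] at hx
    -- On the boundary sphere the value is `-R`, which cancels `‖x‖`, so every gradient is allowed.
    rcases hx.eq_or_lt with hxR | hxR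
    · simp only [radialValue, hxR, sub_self, Real.exp_zero]
      linarith [norm_nonneg (gradientWithin φ (Metric.closedBall 0 R) x)]
    have hnhds : Metric.closedBall (0 : EuclideanSpace ℝ (Fin n)) R ∈ 𝓝 x :=
      mem_of_superset (Metric.isOpen_ball.mem_nhds (by simpa using hxR))
        Metric.ball_subset_closedBall
    have hd : DifferentiableAt ℝ φ x := (hφ.contDiffAt hnhds).differentiableAt one_ne_zero
    rw [gradientWithin_eq_gradient hd (uniqueDiffWithinAt_of_mem_nhds hnhds)]
    -- The outward direction, in which the profile descends. At the origin any unit vector serves,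
    -- and `1 ≤ n` provides one.
    obtain ⟨e, he, hxe⟩ : ∃ e : EuclideanSpace ℝ (Fin n), ‖e‖ = 1 ∧ x = ‖x‖ • e := by
      rcases eq_or_ne x 0 with rfl | hx0
      · exact ⟨EuclideanSpace.single ⟨0, hn⟩ 1, by simp, by simp⟩
      · have : ‖x‖ ≠ 0 := norm_ne_zero_iff.2 hx0
        exact ⟨‖x‖⁻¹ • x, by rw [norm_smul, norm_inv, norm_norm, inv_mul_cancel₀ this],
          by rw [smul_smul, mul_inv_cancel₀ this, one_smul]⟩
    have hnorm : ∀ t : ℝ, 0 ≤ t → ‖x + t • e‖ = ‖x‖ + t := by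
      intro t ht
      have : x + t • e = (‖x‖ + t) • e := by rw [add_smul, ← hxe]
      rw [this, norm_smul, he, mul_one, Real.norm_of_nonneg (by positivity)]
    have hg : HasDerivAt (fun t => Real.exp (‖x‖ + t - R) - (‖x‖ + t) - 1)
        (-(1 - Real.exp (‖x‖ - R))) 0 := by
      have h1 : HasDerivAt (fun t : ℝ => ‖x‖ + t) 1 0 := (hasDerivAt_id 0).const_add _
      have h2 := ((h1.sub_const R).exp.sub h1).sub_const 1
      exact h2.congr_deriv (by rw [add_zero]; ring)
    have hline : Tendsto (fun t : ℝ => x + t • e) (𝓝[>] 0) (𝓝 x) := by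
      have : Continuous fun t : ℝ => x + t • e := by fun_prop
      exact (by simpa using this.tendsto 0 : Tendsto (fun t : ℝ => x + t • e) (𝓝 0) (𝓝 x)).mono_left
        nhdsWithin_le_nhds
    have := le_norm_gradient_of_sub_le hd he hg (by
      filter_upwards [hline.eventually (hmin.isLocalMin hnhds), self_mem_nhdsWithin] with t ht ht0
      rw [mem_Ioi] at ht0
      simp only [radialValue, hnorm t ht0.le] at ht
      rw [add_zero]
      linarith)
    simp only [radialValue]
    linarith

lemma exp_neg_one_mul_le_radialValue_sub {r : ℝ} (hr : 0 ≤ r)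
    (x : EuclideanSpace ℝ (Fin n)) :
    Real.exp (-1) * r ≤ radialValue n (1 - r) x - radialValue n 1 x := by
  have h1 : Real.exp (‖x‖ - (1 - r)) = Real.exp (‖x‖ - 1) * Real.exp r := by
    rw [← Real.exp_add]; congr 1; ring
  have h2 := mul_le_mul_of_nonneg_left (Real.add_one_le_exp r) (Real.exp_pos (‖x‖ - 1)).le
  have h3 : Real.exp (-1) ≤ Real.exp (‖x‖ - 1) :=
    Real.exp_le_exp.2 (by linarith [norm_nonneg x])
  simp only [radialValue, h1]
  nlinarith [mul_le_mul_of_nonneg_right h3 hr]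

end Example

/-! ### Comparison by doubling variables. -/

section Comparison

/-- Covers both variables of the doubled penalty: `θ = 1` for the subsolution, general `θ` and `-c`
for the supersolution. -/
lemma hasGradientAt_norm_sub_sq {E : Type*} [NormedAddCommGroup E] [InnerProductSpace ℝ E]
    [CompleteSpace E] (c θ : ℝ) (a y : E) :
    HasGradientAt (fun y => c * ‖a - θ • y‖ ^ 2) (-(2 * c * θ) • (a - θ • y)) y := by
  rw [hasGradientAt_iff_hasFDerivAt]
  have h := ((((hasFDerivAt_id y).const_smul θ).const_sub a).norm_sq).const_mul c
  refine h.congr_fderiv ?_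
  ext w
  simp only [smul_apply, ContinuousLinearMap.comp_apply, neg_apply,
    ContinuousLinearMap.id_apply, innerSL_apply_apply, InnerProductSpace.toDual_apply_apply,
    inner_smul_left, inner_neg_right, inner_smul_right, smul_eq_mul, nsmul_eq_mul, id_eq,
    Pi.smul_apply, RCLike.conj_to_real]
  push_cast
  ring

variable {n : ℕ} {H : EuclideanSpace ℝ (Fin n) → EuclideanSpace ℝ (Fin n) → ℝ}

lemma IsAdmissibleHamiltonian.exists_norm_le (hH : IsAdmissibleHamiltonian (unitBall n) H)
    (M : ℝ) : ∃ L : ℝ, 0 < L ∧ ∀ x ∈ closure (unitBall n), ∀ p, H x p ≤ M → ‖p‖ ≤ L := by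
  obtain ⟨C₁, -, hC₁⟩ := hH.bddBelow
  obtain ⟨r, -, hr⟩ := (Metric.hasBasis_cobounded_compl_closedBall 0).eventually_iff.1
    (hH.coercive.eventually_gt_atTop M)
  refine ⟨max r 1, by positivity, fun x hx p hp => ?_⟩
  by_contra! hlt
  have h1 := hr (x := p) (by simpa using (le_max_left r 1).trans_lt hlt)
  have h2 : ⨅ x : closure (unitBall n), H x p ≤ H x p :=
    ciInf_le ⟨-C₁, by rintro _ ⟨y, rfl⟩; linarith [hC₁ y y.2 p]⟩ (⟨x, hx⟩ : closure (unitBall n))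
  linarith

/-- A supersolution is bounded from below by the bound for `H(·, 0)`. -/
lemma IsViscositySupersolution.neg_le {s C : ℝ} (hs : 0 < s) (hs1 : s ≤ 1)
    (hC : ∀ x ∈ closure (unitBall n), |H x 0| ≤ C) {v : EuclideanSpace ℝ (Fin n) → ℝ}
    (hv : IsViscositySupersolution H (Metric.ball 0 s) v) :
    ∀ x ∈ Metric.closedBall (0 : EuclideanSpace ℝ (Fin n)) s, -C ≤ v x := by
  obtain ⟨⟨-, hc⟩, hv⟩ := hv
  rw [closure_ball _ hs.ne'] at hc hv
  obtain ⟨z, hz, hmin⟩ := (isCompact_closedBall (0 : EuclideanSpace ℝ (Fin n)) s).exists_isMinOn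
    ⟨0, by simpa using hs.le⟩ hc.continuousOn
  have h := hv z hz (fun _ => 0) contDiffOn_const (by simpa using hmin.localize)
  have h0 : gradientWithin (fun _ : EuclideanSpace ℝ (Fin n) => (0 : ℝ))
      (Metric.closedBall 0 s) z = 0 := by simp [gradientWithin]
  rw [h0] at h
  have hz1 := (abs_le.1 (hC z (by
    rw [unitBall, closure_ball _ one_ne_zero]
    exact Metric.closedBall_subset_closedBall hs1 hz))).2
  intro x hx
  linarith [isMinOn_iff.1 hmin x hx]

lemma IsViscositySubsolution.add_le_of_isLocalMax_norm_sub_sq {Ω : Set (EuclideanSpace ℝ (Fin n))}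
    {v : EuclideanSpace ℝ (Fin n) → ℝ} (hv : IsViscositySubsolution H Ω v) {c : ℝ}
    {a z : EuclideanSpace ℝ (Fin n)} (hz : z ∈ Ω)
    (hmax : IsLocalMax (fun z => v z - c * ‖z - a‖ ^ 2) z) :
    v z + H z ((2 * c) • (z - a)) ≤ 0 := by
  have hφ : (fun z => c * ‖a - (1 : ℝ) • z‖ ^ 2) = fun z => c * ‖z - a‖ ^ 2 := by
    funext z
    rw [one_smul, norm_sub_rev]
  have hgrad := (hasGradientAt_norm_sub_sq c 1 a z).gradient
  rw [hφ, mul_one, one_smul, neg_smul, ← smul_neg, neg_sub] at hgrad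
  rw [← hgrad]
  exact hv.2 z hz _ (ContDiff.contDiffOn
    (contDiff_const.mul ((contDiff_id.sub contDiff_const).norm_sq ℝ))) (hmax.on _)

lemma IsViscositySupersolution.le_add_of_isMinOn_norm_sub_sq {s : ℝ} (hs : 0 < s)
    {w : EuclideanSpace ℝ (Fin n) → ℝ} (hw : IsViscositySupersolution H (Metric.ball 0 s) w)
    {c θ : ℝ} {a y : EuclideanSpace ℝ (Fin n)} (hy : y ∈ Metric.closedBall 0 s)
    (hmin : ∀ y' ∈ Metric.closedBall (0 : EuclideanSpace ℝ (Fin n)) s,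
      w y + c * ‖a - θ • y‖ ^ 2 ≤ w y' + c * ‖a - θ • y'‖ ^ 2) :
    0 ≤ w y + H y (θ • (2 * c) • (a - θ • y)) := by
  have hgrad := hasGradientAt_norm_sub_sq (-c) θ a y
  have huniq : UniqueDiffWithinAt ℝ (Metric.closedBall (0 : EuclideanSpace ℝ (Fin n)) s) y :=
    uniqueDiffOn_convex (convex_closedBall _ _)
      ⟨0, Metric.ball_subset_interior_closedBall (Metric.mem_ball_self hs)⟩ y hy
  have hg := (gradientWithin_eq_gradient hgrad.differentiableAt huniq).trans hgrad.gradient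
  have hp : -(2 * -c * θ) • (a - θ • y) = θ • (2 * c) • (a - θ • y) := by
    rw [smul_smul]
    congr 1
    ring
  have hw2 := hw.2
  rw [closure_ball _ hs.ne'] at hw2
  rw [← hp, ← hg]
  refine hw2 y hy _ (ContDiff.contDiffOn
    (contDiff_const.mul ((contDiff_const.sub (contDiff_id.const_smul θ)).norm_sq ℝ)))
    (IsMinOn.localize (isMinOn_iff.2 fun y' hy' => ?_))
  have := hmin y' hy'
  linarith

/-- Comparison of a subsolution in `B(0, ρ)` with a state-constraint supersolution on the closure
of `B(0, s)`, after a contraction by a factor `θ` with `θ s < ρ`. -/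
theorem comparison_of_contraction {ρ s θ L C : ℝ} (hρ : ρ ≤ 1) (hs : 0 < s) (hs1 : s ≤ 1)
    (hθ0 : 0 ≤ θ) (hθ1 : θ ≤ 1) (hθ : θ * s < ρ) (hL0 : 0 ≤ L) (hC0 : 0 ≤ C)
    (hC : ∀ x ∈ closure (unitBall n), ∀ y ∈ closure (unitBall n),
      ∀ p q : EuclideanSpace ℝ (Fin n), ‖p‖ ≤ L → ‖q‖ ≤ L →
        |H x p - H y p| ≤ C * ‖x - y‖ ∧ |H x p - H x q| ≤ C * ‖p - q‖)
    {v w : EuclideanSpace ℝ (Fin n) → ℝ}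
    (hv : IsViscositySubsolution H (Metric.ball 0 ρ) v)
    (hL : ∀ x ∈ Metric.ball (0 : EuclideanSpace ℝ (Fin n)) ρ, ∀ p, v x + H x p ≤ 0 → ‖p‖ ≤ L)
    (hw : IsViscositySupersolution H (Metric.ball 0 s) w)
    {x : EuclideanSpace ℝ (Fin n)} (hx : x ∈ Metric.closedBall 0 s) :
    v (θ • x) - w x ≤ C * ((1 - θ) * (1 + L)) := by
  obtain ⟨M, hM⟩ := hv.1.1
  have hvc := hv.1.2
  have hwc := hw.1.2
  rw [closure_ball _ hs.ne'] at hwc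
  rw [unitBall, closure_ball _ one_ne_zero] at hC
  obtain ⟨ρ', h1, h2⟩ := exists_between hθ
  have hsub : Metric.closedBall (0 : EuclideanSpace ℝ (Fin n)) ρ' ⊆ Metric.ball 0 ρ :=
    Metric.closedBall_subset_ball h2
  have hscale : ∀ y ∈ Metric.closedBall (0 : EuclideanSpace ℝ (Fin n)) s, ‖θ • y‖ ≤ θ * s := by
    intro y hy
    rw [norm_smul, Real.norm_of_nonneg hθ0]
    exact mul_le_mul_of_nonneg_left (by simpa using hy) hθ0
  have hscale' : ∀ y ∈ Metric.closedBall (0 : EuclideanSpace ℝ (Fin n)) s,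
      θ • y ∈ Metric.closedBall (0 : EuclideanSpace ℝ (Fin n)) ρ' := fun y hy => by
    simpa using (hscale y hy).trans h1.le
  have hM0 : 0 ≤ M := (abs_nonneg _).trans (hM _ (hsub (hscale' x hx)))
  set d := ρ' - θ * s with hd
  have hd0 : 0 < d := sub_pos.2 h1
  -- The penalty at the maximum is at most `2M`, so this smallness of `ε` forces `‖z - θ • y‖ < d`
  -- and keeps `z` off the sphere of radius `ρ'`.
  have key : ∀ ε : ℝ, 0 < ε → 4 * M * ε < d ^ 2 →
      v (θ • x) - w x ≤ C * ((1 - θ) + L * ε) + C * ((1 - θ) * L) := by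
    intro ε hε hεd
    obtain ⟨⟨z, y⟩, ⟨hz, hy⟩, hmax⟩ := ((isCompact_closedBall (0 : EuclideanSpace ℝ (Fin n))
        ρ').prod (isCompact_closedBall (0 : EuclideanSpace ℝ (Fin n)) s)).exists_isMaxOn
      (f := fun q => v q.1 - w q.2 - 1 / (2 * ε) * ‖q.1 - θ • q.2‖ ^ 2)
      ⟨(θ • x, x), hscale' x hx, hx⟩ (by
        refine ContinuousOn.sub (ContinuousOn.sub ?_ ?_) (by fun_prop)
        · exact (hvc.continuousOn.mono hsub).comp continuousOn_fst fun q hq => hq.1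
        · exact hwc.continuousOn.comp continuousOn_snd fun q hq => hq.2)
    simp only at hz hy
    rw [isMaxOn_iff] at hmax
    have hxx := hmax (θ • x, x) ⟨hscale' x hx, hx⟩
    -- Here `w y` cancels, so the penalty is controlled by the bound on `v` alone.
    have hyy := hmax (θ • y, y) ⟨hscale' y hy, hy⟩
    simp only [sub_self, norm_zero, ne_eq, OfNat.ofNat_ne_zero, not_false_eq_true, zero_pow,
      mul_zero, sub_zero] at hxx hyy
    obtain ⟨p, hp⟩ : ∃ p, p = (1 / ε) • (z - θ • y) := ⟨_, rfl⟩
    have h2ε : (2 * (1 / (2 * ε))) • (z - θ • y) = p := by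
      rw [hp]; congr 1; field_simp
    have hzy : ‖z - θ • y‖ < d := by
      have b1 := (abs_le.1 (hM _ (hsub hz))).2
      have b2 := (abs_le.1 (hM _ (hsub (hscale' y hy)))).1
      have : 1 / (2 * ε) * ‖z - θ • y‖ ^ 2 ≤ 2 * M := by linarith
      rw [one_div_mul_eq_div, div_le_iff₀ (by positivity)] at this
      exact lt_of_pow_lt_pow_left₀ 2 hd0.le (by linarith)
    have hzlt : ‖z‖ < ρ' := by
      have := norm_add_le (z - θ • y) (θ • y)
      rw [sub_add_cancel] at this
      linarith [hscale y hy]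
    have hsubz : v z + H z p ≤ 0 := by
      have h := hv.add_le_of_isLocalMax_norm_sub_sq (c := 1 / (2 * ε)) (a := θ • y) (hsub hz) (by
        filter_upwards [Metric.isOpen_ball.mem_nhds (mem_ball_zero_iff.2 hzlt)] with z' hz'
        have := hmax (z', y) ⟨Metric.ball_subset_closedBall hz', hy⟩
        simp only at this
        linarith)
      rwa [h2ε] at h
    have hsupy : 0 ≤ w y + H y (θ • p) := by
      have h := IsViscositySupersolution.le_add_of_isMinOn_norm_sub_sq hs hw
        (c := 1 / (2 * ε)) (θ := θ) (a := z) hy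
        fun y' hy' => by
          have := hmax (z, y') ⟨hz, hy'⟩
          simp only at this
          linarith
      rwa [h2ε] at h
    -- Since `p = (z - θ • y) / ε`, this also gives `‖z - θ • y‖ ≤ L ε`. The rest estimates `H y (θ
    -- • p) - H z p` by the Lipschitz bounds.
    have hpL : ‖p‖ ≤ L := hL z (hsub hz) p hsubz
    have hzyL : ‖z - θ • y‖ ≤ L * ε := by
      rw [hp, norm_smul, Real.norm_of_nonneg (by positivity), one_div_mul_eq_div,
        div_le_iff₀ hε] at hpL
      exact hpL
    have hθp : ‖θ • p‖ ≤ L := by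
      rw [norm_smul, Real.norm_of_nonneg hθ0]
      nlinarith [norm_nonneg p]
    have hz1 : z ∈ Metric.closedBall (0 : EuclideanSpace ℝ (Fin n)) 1 :=
      Metric.closedBall_subset_closedBall (h2.le.trans hρ) hz
    have hy1 : y ∈ Metric.closedBall (0 : EuclideanSpace ℝ (Fin n)) 1 :=
      Metric.closedBall_subset_closedBall hs1 hy
    have e1 := (abs_le.1 (hC y hy1 z hz1 (θ • p) (θ • p) hθp hθp).1).2
    have e2 := (abs_le.1 (hC z hz1 z hz1 (θ • p) p hθp hpL).2).2
    have e3 : ‖θ • p - p‖ ≤ (1 - θ) * L := by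
      have : θ • p - p = -((1 - θ) • p) := by rw [sub_smul, one_smul, neg_sub]
      rw [this, norm_neg, norm_smul, Real.norm_of_nonneg (sub_nonneg.2 hθ1)]
      exact mul_le_mul_of_nonneg_left hpL (sub_nonneg.2 hθ1)
    have e4 : ‖y - z‖ ≤ (1 - θ) + L * ε := by
      have h : y - z = (1 - θ) • y - (z - θ • y) := by rw [sub_smul, one_smul]; abel
      have hyn : ‖(1 - θ) • y‖ ≤ 1 - θ := by
        rw [norm_smul, Real.norm_of_nonneg (sub_nonneg.2 hθ1)]
        exact mul_le_of_le_one_right (sub_nonneg.2 hθ1) (by simpa using hy1)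
      rw [h]
      exact (norm_sub_le _ _).trans (add_le_add hyn hzyL)
    have e5 : 0 ≤ 1 / (2 * ε) * ‖z - θ • y‖ ^ 2 := by positivity
    linarith [mul_le_mul_of_nonneg_left e3 hC0, mul_le_mul_of_nonneg_left e4 hC0]
  have hlim : Tendsto (fun ε : ℝ => C * ((1 - θ) + L * ε) + C * ((1 - θ) * L)) (𝓝[>] 0)
      (𝓝 (C * ((1 - θ) * (1 + L)))) := by
    have hc : Continuous fun ε : ℝ => C * ((1 - θ) + L * ε) + C * ((1 - θ) * L) := by fun_prop
    have := (hc.tendsto 0).mono_left (nhdsWithin_le_nhds (s := Ioi 0))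
    convert this using 2
    ring
  refine ge_of_tendsto hlim ?_
  have hsmall : ∀ᶠ ε : ℝ in 𝓝 0, 4 * M * ε < d ^ 2 := by
    have hc : Continuous fun ε : ℝ => 4 * M * ε := by fun_prop
    exact (hc.tendsto 0).eventually_lt_const (by simpa using pow_pos hd0 2)
  filter_upwards [hsmall.filter_mono nhdsWithin_le_nhds, self_mem_nhdsWithin] with ε h3 h4
  exact key ε h4 h3

end Comparison

/-- The solution on `B(0, 1 - 1/k)` exceeds the solution on `B(0, 1)` by at most `O(1/k)`. -/
theorem exists_rate {n : ℕ} {H : EuclideanSpace ℝ (Fin n) → EuclideanSpace ℝ (Fin n) → ℝ}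
    (hH : IsAdmissibleHamiltonian (unitBall n) H) :
      ∃ C : ℝ, 0 < C ∧
        ∀ u : EuclideanSpace ℝ (Fin n) → ℝ,
          IsStateConstraintSolution H (unitBall n) u →
        ∀ k : ℕ, 2 ≤ k →
        ∀ uk : EuclideanSpace ℝ (Fin n) → ℝ,
          IsStateConstraintSolution H (nestedBall n k) uk →
        ∀ x ∈ Metric.closedBall (0 : EuclideanSpace ℝ (Fin n)) (1 - 1 / (k : ℝ)),
          0 ≤ uk x - u x ∧ uk x - u x ≤ C / k := by
  obtain ⟨C₂, hC₂, hzero⟩ := hH.bdd_zero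
  obtain ⟨L, hL, hLp⟩ := hH.exists_norm_le C₂
  obtain ⟨C₀, hC₀⟩ := hH.lipschitz L hL
  obtain ⟨C, hCdef⟩ : ∃ C, C = max C₀ 0 := ⟨_, rfl⟩
  have hC0 : 0 ≤ C := hCdef ▸ le_max_right _ _
  have hC : ∀ x ∈ closure (unitBall n), ∀ y ∈ closure (unitBall n),
      ∀ p q : EuclideanSpace ℝ (Fin n), ‖p‖ ≤ L → ‖q‖ ≤ L →
        |H x p - H y p| ≤ C * ‖x - y‖ ∧ |H x p - H x q| ≤ C * ‖p - q‖ := by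
    intro x hx y hy p q hp hq
    have h := hC₀ x hx y hy p q hp hq
    have hle : C₀ ≤ C := hCdef ▸ le_max_left _ _
    exact ⟨h.1.trans (by gcongr), h.2.trans (by gcongr)⟩
  have hbound : ∀ (r : ℝ) (v : EuclideanSpace ℝ (Fin n) → ℝ), 0 < r → r ≤ 1 →
      IsStateConstraintSolution H (Metric.ball 0 r) v →
      ∀ x ∈ Metric.ball (0 : EuclideanSpace ℝ (Fin n)) r, ∀ p, v x + H x p ≤ 0 → ‖p‖ ≤ L := by
    intro r v hr hr1 hv x hx p hp
    have := hv.2.neg_le hr hr1 hzero x (Metric.ball_subset_closedBall hx)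
    exact hLp x (subset_closure (Metric.ball_subset_ball hr1 hx)) p (by linarith)
  -- With `1 - θ = 2/k`, the first term comes from the Lipschitz constant `2L` and the second from
  -- comparison.
  refine ⟨4 * L + 2 * C * (1 + L), by positivity, fun u hu k hk uk huk x hx => ?_⟩
  have hk2 : (2 : ℝ) ≤ k := by exact_mod_cast hk
  have hk1 : 1 / (k : ℝ) ≤ 1 / 2 := one_div_le_one_div_of_le two_pos hk2
  have hk0 : 0 < 1 / (k : ℝ) := by positivity
  have hbu := hbound 1 u one_pos le_rfl hu
  have hbk := hbound _ uk (by linarith) (by linarith) huk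
  constructor
  · have := comparison_of_contraction le_rfl (by linarith) (by linarith) zero_le_one le_rfl
      (by linarith) hL.le hC0 hC hu.1 hbu huk.2 hx
    rw [one_smul, sub_self, zero_mul, mul_zero] at this
    linarith
  · set ρ := 1 - 1 / (k : ℝ) with hρ
    -- Comparison needs `θ < ρ` strictly, which excludes `θ = 1 - 1/k`; `2 ≤ k` keeps this `θ`
    -- nonnegative.
    set θ := 1 - 2 * (1 / (k : ℝ)) with hθ
    have hθ0 : 0 ≤ θ := by linarith
    have hx1 : x ∈ Metric.closedBall (0 : EuclideanSpace ℝ (Fin n)) 1 :=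
      Metric.closedBall_subset_closedBall (by linarith) hx
    have hcmp := comparison_of_contraction (by linarith) one_pos le_rfl hθ0 (by linarith)
      (by linarith) hL.le hC0 hC huk.1 hbk hu.2 hx1
    have hlip : uk x - uk (θ • x) ≤ 2 * L * (1 - θ) := by
      have hθx : θ • x ∈ Metric.ball (0 : EuclideanSpace ℝ (Fin n)) ρ := by
        rw [mem_ball_zero_iff, norm_smul, Real.norm_of_nonneg hθ0]
        nlinarith [mem_closedBall_zero_iff.1 hx]
      obtain ⟨⟨⟨M, hM⟩, hkc⟩, hksub⟩ := huk.1
      have hkc' : ContinuousOn uk (closure (Metric.ball 0 ρ)) := huk.2.1.2.continuousOn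
      have hxcl : x ∈ closure (Metric.ball (0 : EuclideanSpace ℝ (Fin n)) ρ) := by
        rwa [closure_ball _ (by linarith)]
      -- The Lipschitz estimate holds in the open ball; continuity extends it to `x` on the
      -- boundary.
      have hle : uk x ≤ uk (θ • x) + 2 * L * ‖x - θ • x‖ := by
        refine ContinuousWithinAt.closure_le (f := uk)
          (g := fun y => uk (θ • x) + 2 * L * ‖y - θ • x‖) hxcl
          ((hkc' x hxcl).mono subset_closure) (by fun_prop) fun y hy => ?_
        have := sub_le_of_norm_gradient_le hL hkc.continuousOn hM
          (fun z hz φ hφ hmax => hbk z hz _ (hksub z hz φ hφ.contDiffOn hmax)) hy hθx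
        linarith
      have hnorm : ‖x - θ • x‖ ≤ 1 - θ := by
        have : x - θ • x = (1 - θ) • x := by rw [sub_smul (1 : ℝ) θ, one_smul]
        rw [this, norm_smul, Real.norm_of_nonneg (by linarith)]
        exact mul_le_of_le_one_right (by linarith) (by simpa using hx1)
      nlinarith
    have : (4 * L + 2 * C * (1 + L)) / k = 2 * L * (1 - θ) + C * ((1 - θ) * (1 + L)) := by
      rw [hθ]; ring
    linarith

end StateConstraint

theorem theorem1p5 (n : ℕ) (hn : 1 ≤ n) :
    (∀ H : EuclideanSpace ℝ (Fin n) → EuclideanSpace ℝ (Fin n) → ℝ,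
      StateConstraint.IsAdmissibleHamiltonian (StateConstraint.unitBall n) H →
      ∃ C : ℝ, 0 < C ∧
        ∀ u : EuclideanSpace ℝ (Fin n) → ℝ,
          StateConstraint.IsStateConstraintSolution H (StateConstraint.unitBall n) u →
        ∀ k : ℕ, 2 ≤ k →
        ∀ uk : EuclideanSpace ℝ (Fin n) → ℝ,
          StateConstraint.IsStateConstraintSolution H (StateConstraint.nestedBall n k) uk →
        ∀ x ∈ Metric.closedBall (0 : EuclideanSpace ℝ (Fin n)) (1 - 1 / (k : ℝ)),
          0 ≤ uk x - u x ∧ uk x - u x ≤ C / k) ∧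
    -- optimality of the rate
    (∃ H : EuclideanSpace ℝ (Fin n) → EuclideanSpace ℝ (Fin n) → ℝ,
      StateConstraint.IsAdmissibleHamiltonian (StateConstraint.unitBall n) H ∧
      ∃ (u : EuclideanSpace ℝ (Fin n) → ℝ) (uk : ℕ → EuclideanSpace ℝ (Fin n) → ℝ),
        StateConstraint.IsStateConstraintSolution H (StateConstraint.unitBall n) u ∧
        (∀ k : ℕ, 2 ≤ k →
          StateConstraint.IsStateConstraintSolution H (StateConstraint.nestedBall n k) (uk k)) ∧
        ∃ c : ℝ, 0 < c ∧ ∀ k : ℕ, 2 ≤ k →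
          ∀ x ∈ Metric.closedBall (0 : EuclideanSpace ℝ (Fin n)) (1 - 1 / (k : ℝ)),
            c / k ≤ uk k x - u x) := by 
  refine ⟨fun H hH => StateConstraint.exists_rate hH, fun x p => ‖p‖ + ‖x‖,
    StateConstraint.isAdmissibleHamiltonian_norm_add_norm n, StateConstraint.radialValue n 1,
    fun k => StateConstraint.radialValue n (1 - 1 / (k : ℝ)),
    StateConstraint.isStateConstraintSolution_radialValue hn one_pos, fun k hk => ?_,
    Real.exp (-1), Real.exp_pos _, fun k _ x _ => ?_⟩
  · refine StateConstraint.isStateConstraintSolution_radialValue hn ?_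
    have hk2 : (2 : ℝ) ≤ k := by exact_mod_cast hk
    have := one_div_le_one_div_of_le two_pos hk2
    linarith
  · rw [div_eq_mul_one_div]
    exact StateConstraint.exp_neg_one_mul_le_radialValue_sub (by positivity) x
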